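/- **Setting.** Let $X\subset\mathbb R^n$ be compact, let $\mu$ be a Borel probability measure on $X$ that is absolutely continuous with respect to Lebesgue measure, let $Y=\{y_1,\dots,y_N\}$ be a finite set of $N$ distinct points, and let $c:X\times Y\to\mathbb R$ be a cost with $c(\cdot,y_j)\in C^1(X)$ for every $j$. Assume the twist condition: $-\nabla_x c(x,y_j)\neq-\nabla_x c(x,y_k)$ for all $x\in X$ and $j\ne k$. (Here $f\in C^1(X)$ means that there is a continuous field $\nabla f:X\to\mathbb R^n$ with $f(z)=f(x)+\langle\nabla f(x),z-x\rangle+o(|z-x|)$ as $z\to x$ in $X$, for each $x\in X$; the twist condition refers to a fixed choice of such fields.) Let $$\Lambda=\Big\{\lambda\in\mathbb R^N:\ \lambda^j\ge 0\ \text{for all } j,\ \sum_{j}\lambda^j=1\Big\},\qquad \nu_\lambda=\sum_{j=1}^N\lambda^j\delta_{y_j}\quad(\lambda\in\Lambda),$$ and let $F:\mathbb R^N\to\mathbb R\cup\{+\infty\}$ be convex, not identically $+\infty$, and equal to $+\infty$ outside $\Lambda$. Write $$F^*(\psi)=\sup_{\lambda\in\mathbb R^N}(\langle\lambda,\psi\rangle-F(\lambda)),\qquad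 \partial F(\lambda)=\{p\in\mathbb R^N:\ F(\eta)\ge F(\lambda)+\langle \eta-\lambda,p\rangle\ \ \forall \eta\in\mathbb R^N\},$$ $$\psi^{c^*}(x)=\max_{1\le j\le N}(-c(x,y_j)-\psi^j),\qquad (\varphi^{c})^j=\sup_{x\in X}(-c(x,y_j)-\varphi(x)),\qquad \psi^{c^*c}=(\psi^{c^*})^c .$$ Let $\Pi(\mu,\nu)$ be the set of couplings of $\mu$ and $\nu$, that is, measures on $X\times Y$ with marginals $\mu$ and $\nu$. The *primal problem* is to minimize $\int_{X\times Y}c\,d\gamma+F(\lambda)$ over $\lambda\in\Lambda$, $\gamma\in\Pi(\mu,\nu_\lambda)$. The *dual problem* is to maximize $-\int_X\varphi\,d\mu-F^*(\psi)$ over $(\varphi,\psi)\in C(X)\times\mathbb R^N$ with $-\varphi(x)-\psi^j\le c(x,y_j)$ for all $x\in X$ and $1\le j\le N$. **Theorem.** If $(\hat\varphi,\hat\psi)$ is a maximizing pair in the dual problem and $(\tilde\gamma,\tilde\lambda)$ is a minimizing pair in the primal problem, then (i) $\hat\psi\in\partial F(\tilde\lambda)$; (ii) $\tilde\lambda^j=\mu(\{x\in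 X:\ -c(x,y_j)-\hat\psi^j=\hat\psi^{c^*}(x)\})$ for every $1\le j\le N$; and furthermore, for each $j$ with $\tilde\lambda^j>0$, (iii) $\hat\psi^j=(\hat\psi^{c^*c})^j$. Conversely, let $\tilde\lambda\in\Lambda$ and $\hat\psi\in\mathbb R^N$ satisfy (i) and (ii). Then for $\mu$-a.e. $x\in X$ there is a unique index $j$ with $-c(x,y_j)-\hat\psi^j=\hat\psi^{c^*}(x)$, and there is a measurable map $T_{\hat\psi}:X\to Y$ with $T_{\hat\psi}(x)=y_j$ at each such $x$. For every map $T_{\hat\psi}$ with this property (with arbitrary values at the remaining points $x$), the pair $(\hat\psi^{c^*},\hat\psi)$ is maximizing in the dual problem and $((\mathrm{Id}\times T_{\hat\psi})_\#\mu,\ \tilde\lambda)$ is minimizing in the primal problem. -/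

import Mathlib

open MeasureTheory

noncomputable section

namespace StorageFees

/-- `f` is of class `C¹` on the (arbitrary) set `X ⊆ ℝⁿ`, with gradient field `g`:
at each point of `X`, `g` is a gradient of `f` relative to `X`, and `g` is continuous on `X`.
(This holds with `g = ∇f` if `f` is `C¹` near `X`; where `X` has unique derivatives, `g` is
determined by the restriction of `f` to `X`.) -/
structure IsC1With {n : ℕ} (X : Set (EuclideanSpace ℝ (Fin n)))
    (f : EuclideanSpace ℝ (Fin n) → ℝ)
    (g : EuclideanSpace ℝ (Fin n) → EuclideanSpace ℝ (Fin n)) : Prop where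
  hasGradientWithinAt : ∀ x ∈ X, HasGradientWithinAt f (g x) X x
  continuousOn : ContinuousOn g X

/-- The twist condition, where `g j x` stands for `∇ₓ c (x, y_j)`. -/
def Twist {n N : ℕ} (X : Set (EuclideanSpace ℝ (Fin n)))
    (g : Fin N → EuclideanSpace ℝ (Fin n) → EuclideanSpace ℝ (Fin n)) : Prop :=
  ∀ x ∈ X, ∀ j k : Fin N, j ≠ k → -g j x ≠ -g k x

/-- Weight vectors: the probability simplex `Λ` in `ℝᴺ`. -/
def weights (N : ℕ) : Set (Fin N → ℝ) :=
  {w | (∀ j, 0 ≤ w j) ∧ ∑ j, w j = 1}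

/-- The pairing `⟨w, ψ⟩ = ∑ⱼ wʲ ψʲ` on `ℝᴺ`. -/
def pairing {N : ℕ} (w ψ : Fin N → ℝ) : ℝ := ∑ j, w j * ψ j

/-- A storage fee function: a proper convex function `F : ℝᴺ → ℝ ∪ {+∞}` equal to `+∞`
outside the simplex of weight vectors. -/
structure IsStorageFee {N : ℕ} (F : (Fin N → ℝ) → EReal) : Prop where
  ne_bot : ∀ w, F w ≠ ⊥
  convex : ∀ v w : Fin N → ℝ, ∀ a b : ℝ, 0 < a → 0 < b → a + b = 1 →
    F (a • v + b • w) ≤ (a : EReal) * F v + (b : EReal) * F w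
  proper : ∃ w, F w ≠ ⊤
  eq_top : ∀ w, w ∉ weights N → F w = ⊤

/-- Legendre transform `F*(ψ) = sup_w (⟨w, ψ⟩ - F w)`. -/
def legendre {N : ℕ} (F : (Fin N → ℝ) → EReal) (ψ : Fin N → ℝ) : EReal :=
  ⨆ w : Fin N → ℝ, ((pairing w ψ : ℝ) : EReal) - F w

/-- The subdifferential `∂F(w) = {p | F v ≥ F w + ⟨v - w, p⟩ for all v}`. -/
def subdiff {N : ℕ} (F : (Fin N → ℝ) → EReal) (w : Fin N → ℝ) : Set (Fin N → ℝ) :=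
  {p | ∀ v, F w + ((pairing (v - w) p : ℝ) : EReal) ≤ F v}

section Transport

variable {n N : ℕ} {X : Set (EuclideanSpace ℝ (Fin n))} {Y : Type*}

/-- `ψ^{c*}(x) = max_j (-c(x, y_j) - ψʲ)`. -/
def cstar (c : EuclideanSpace ℝ (Fin n) → Y → ℝ) (y : Fin N ≃ Y) (ψ : Fin N → ℝ) (x : X) : ℝ :=
  ⨆ j, (-c x (y j) - ψ j)

/-- `(φ^c)ʲ = sup_{x ∈ X} (-c(x, y_j) - φ(x))`. -/
def ctrans (c : EuclideanSpace ℝ (Fin n) → Y → ℝ) (y : Fin N ≃ Y) (φ : X → ℝ) (j : Fin N) : ℝ :=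
  ⨆ x : X, (-c x (y j) - φ x)

/-- `j` attains the maximum defining `ψ^{c*}(x)`. -/
def Attains (c : EuclideanSpace ℝ (Fin n) → Y → ℝ) (y : Fin N ≃ Y) (ψ : Fin N → ℝ)
    (x : X) (j : Fin N) : Prop :=
  -c x (y j) - ψ j = cstar c y ψ x

/-- `T` is a version of `T_ψ`: `T x = y_j` whenever `j` is the unique index attaining the
maximum defining `ψ^{c*}(x)` (no condition where there are several). -/
def IsMapOf (c : EuclideanSpace ℝ (Fin n) → Y → ℝ) (y : Fin N ≃ Y) (ψ : Fin N → ℝ)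
    (T : X → Y) : Prop :=
  ∀ x j, Attains c y ψ x j → (∀ k, Attains c y ψ x k → k = j) → T x = y j

variable [MeasurableSpace Y]

/-- `ν_w = ∑ⱼ wʲ δ_{y_j}`. -/
def targetMeasure (y : Fin N ≃ Y) (w : Fin N → ℝ) : Measure Y :=
  ∑ j, ENNReal.ofReal (w j) • Measure.dirac (y j)

/-- The set `Π(μ, ν)` of couplings. -/
def couplings (μ : Measure X) (ν : Measure Y) : Set (Measure (X × Y)) :=
  {γ | γ.map Prod.fst = μ ∧ γ.map Prod.snd = ν}

/-- The primal objective `∫ c dγ + F(w)`. -/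
def primalValue (c : EuclideanSpace ℝ (Fin n) → Y → ℝ) (F : (Fin N → ℝ) → EReal)
    (γ : Measure (X × Y)) (w : Fin N → ℝ) : EReal :=
  ((∫ p, c p.1 p.2 ∂γ : ℝ) : EReal) + F w

/-- `(γ, w)` minimizes the primal objective among `w ∈ Λ`, `γ ∈ Π(μ, ν_w)`. -/
def IsPrimalMinimizer (c : EuclideanSpace ℝ (Fin n) → Y → ℝ) (y : Fin N ≃ Y)
    (F : (Fin N → ℝ) → EReal) (μ : Measure X) (γ : Measure (X × Y)) (w : Fin N → ℝ) : Prop :=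
  w ∈ weights N ∧ γ ∈ couplings μ (targetMeasure y w) ∧
    ∀ w' ∈ weights N, ∀ γ' ∈ couplings μ (targetMeasure y w'),
      primalValue c F γ w ≤ primalValue c F γ' w'

/-- Dual admissibility: `φ ∈ C(X)` and `-φ(x) - ψʲ ≤ c(x, y_j)` for all `x ∈ X` and `j`. -/
def DualAdmissible (c : EuclideanSpace ℝ (Fin n) → Y → ℝ) (y : Fin N ≃ Y)
    (φ : X → ℝ) (ψ : Fin N → ℝ) : Prop :=
  Continuous φ ∧ ∀ x j, -φ x - ψ j ≤ c x (y j)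

/-- The dual objective `-∫ φ dμ - F*(ψ)`. -/
def dualValue (F : (Fin N → ℝ) → EReal) (μ : Measure X) (φ : X → ℝ) (ψ : Fin N → ℝ) : EReal :=
  ((-∫ x, φ x ∂μ : ℝ) : EReal) - legendre F ψ

/-- `(φ, ψ)` maximizes the dual objective among all admissible pairs. -/
def IsDualMaximizer (c : EuclideanSpace ℝ (Fin n) → Y → ℝ) (y : Fin N ≃ Y)
    (F : (Fin N → ℝ) → EReal) (μ : Measure X) (φ : X → ℝ) (ψ : Fin N → ℝ) : Prop :=
  DualAdmissible c y φ ψ ∧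
    ∀ φ' ψ', DualAdmissible c y φ' ψ' → dualValue F μ φ' ψ' ≤ dualValue F μ φ ψ

/-- Condition (ii): `wʲ = μ {x ∈ X | -c(x, y_j) - ψʲ = ψ^{c*}(x)}` for every `j`. -/
def CellMasses (c : EuclideanSpace ℝ (Fin n) → Y → ℝ) (y : Fin N ≃ Y) (μ : Measure X)
    (w ψ : Fin N → ℝ) : Prop :=
  ∀ j, w j = μ.real {x : X | -c x (y j) - ψ j = cstar c y ψ x}

end Transport

end StorageFees

end

/-! By the twist condition, the set where two indices tie for the maximum in `ψ^{c*}` lies in a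
level set of `c(·, y_j) - c(·, y_k)`, whose gradient never vanishes. It is therefore Lebesgue null,
hence `μ`-null. So the cells of `ψ` partition `X` up to a null set, and `ψ ↦ ∫ ψ^{c*} dμ` has
directional derivatives `-⟨w', h⟩`, where `w'` is the vector of cell masses
(`tendsto_integral_cstar_slope`).

A dual maximizer `ψ` minimizes `∫ ψ^{c*} dμ + F*`, so first-order optimality makes `w'` a
subgradient of `F*` at `ψ`. If `F` were lower semicontinuous, `F(w') = ⟨w', ψ⟩ - F*(ψ)` would
follow, and the plan of `T_ψ` would attain the dual value. In general this value is only approached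
by `F` near `w'` (`mem_closure_epigraph`). Nearby weights in the domain of `F` are mixtures
dominated by `w'`, so their transport cost is almost no larger, and there is still no duality gap
(`primal_bound_le`).

For a dual maximizer and a primal minimizer, the gap is the integral of the slack `c + φ + ψ` plus
the Fenchel–Young deficit. Both are nonnegative, so both vanish (`complementary_slackness`). The
deficit gives (i), and the slack concentrates the plan on maximizing indices, which gives (ii) and
(iii). The converse is weak duality with equality. -/

open Filter Topology

namespace StorageFees

/-! ### Level sets of functions with nonvanishing gradient -/

/-- A level set of a function which has a nonzero gradient, relative to the set, at each of its
points is Lebesgue null. -/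
theorem volume_eq_zero_of_hasGradientWithinAt_const {n : ℕ} {A : Set (EuclideanSpace ℝ (Fin n))}
    (hA : MeasurableSet A) (a : ℝ) (d : EuclideanSpace ℝ (Fin n) → EuclideanSpace ℝ (Fin n))
    (hd : ∀ x ∈ A, HasGradientWithinAt (fun _ => a) (d x) A x) (hd0 : ∀ x ∈ A, d x ≠ 0) :
    volume A = 0 := by
  rcases A.eq_empty_or_nonempty with rfl | ⟨x₀, hx₀⟩
  · simp
  -- `norm_fderiv_sub_le` concerns maps of the space to itself, so the constant is multiplied by the
  -- nonzero vector `d x₀`. A constant map is approximated by the zero map with error 0, which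
  -- forces its derivative relative to `A` to vanish at almost every point of `A`.
  have h0 : ApproximatesLinearOn
      (fun _ : EuclideanSpace ℝ (Fin n) => a • d x₀)
      (0 : EuclideanSpace ℝ (Fin n) →L[ℝ] EuclideanSpace ℝ (Fin n)) A 0 := by
    intro x _ y _
    simp
  have h := h0.norm_fderiv_sub_le volume hA
    (fun x => ((InnerProductSpace.toDual ℝ _) (d x)).smulRight (d x₀))
    (fun x hx => (hasGradientWithinAt_iff_hasFDerivWithinAt.1 (hd x hx)).smul_const (d x₀))
  rw [ae_restrict_iff' hA] at h
  rw [measure_eq_zero_iff_ae_notMem]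
  filter_upwards [h] with x hx hxA
  have h1 := hx hxA
  simp only [sub_zero, nonpos_iff_eq_zero, nnnorm_eq_zero] at h1
  -- Evaluating the vanishing derivative at `d x` gives `|d x|² • d x₀ = 0`.
  have h2 := congrArg (fun L => L (d x)) h1
  simp only [ContinuousLinearMap.smulRight_apply, InnerProductSpace.toDual_apply_apply,
    zero_apply, smul_eq_zero, inner_self_eq_zero] at h2
  exact h2.elim (hd0 x hxA) (hd0 x₀ hx₀)

section

variable {n N : ℕ} {X : Set (EuclideanSpace ℝ (Fin n))} {Y : Type*}
  {c : EuclideanSpace ℝ (Fin n) → Y → ℝ} {y : Fin N ≃ Y}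
  {g : Fin N → EuclideanSpace ℝ (Fin n) → EuclideanSpace ℝ (Fin n)}

theorem IsC1With.continuous_restrict {f : EuclideanSpace ℝ (Fin n) → ℝ}
    {d : EuclideanSpace ℝ (Fin n) → EuclideanSpace ℝ (Fin n)} (h : IsC1With X f d) :
    Continuous fun x : X => f x :=
  continuousOn_iff_continuous_domRestrict.1 fun x hx =>
    (hasGradientWithinAt_iff_hasFDerivWithinAt.1 (h.hasGradientWithinAt x hx)).continuousWithinAt

/-! ### The transform `ψ ↦ ψ^{c*}` -/

theorem le_cstar (ψ : Fin N → ℝ) (x : X) (j : Fin N) : -c x (y j) - ψ j ≤ cstar c y ψ x :=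
  le_ciSup (f := fun j => -c x (y j) - ψ j) (Set.finite_range _).bddAbove j

theorem exists_attains [Nonempty (Fin N)] (ψ : Fin N → ℝ) (x : X) : ∃ j, Attains c y ψ x j :=
  exists_eq_ciSup_of_finite (f := fun j => -c x (y j) - ψ j)

theorem cstar_le [Nonempty (Fin N)] {ψ : Fin N → ℝ} {x : X} {b : ℝ}
    (h : ∀ j, -c x (y j) - ψ j ≤ b) : cstar c y ψ x ≤ b :=
  ciSup_le h

theorem continuous_cstar [Nonempty (Fin N)] (hc : ∀ j, Continuous fun x : X => c x (y j))
    (ψ : Fin N → ℝ) : Continuous (cstar (X := X) c y ψ) := by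
  have h : cstar (X := X) c y ψ = fun x : X =>
      Finset.univ.sup' Finset.univ_nonempty fun j => -c x (y j) - ψ j := by
    funext x
    rw [Finset.sup'_univ_eq_ciSup]
    rfl
  rw [h]
  exact Continuous.finset_sup'_apply _ fun j _ => (hc j).neg.sub continuous_const

theorem dualAdmissible_cstar [Nonempty (Fin N)] (hc : ∀ j, Continuous fun x : X => c x (y j))
    (ψ : Fin N → ℝ) : DualAdmissible (X := X) c y (cstar c y ψ) ψ :=
  ⟨continuous_cstar hc ψ, fun x j => by linarith [le_cstar (c := c) (y := y) ψ x j]⟩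

theorem DualAdmissible.cstar_le [Nonempty (Fin N)] {φ : X → ℝ} {ψ : Fin N → ℝ}
    (h : DualAdmissible c y φ ψ) (x : X) : cstar c y ψ x ≤ φ x :=
  StorageFees.cstar_le fun j => by linarith [h.2 x j]

theorem isClosed_attains [Nonempty (Fin N)] (hc : ∀ j, Continuous fun x : X => c x (y j))
    (ψ : Fin N → ℝ) (j : Fin N) : IsClosed {x : X | Attains c y ψ x j} :=
  isClosed_eq ((hc j).neg.sub continuous_const) (continuous_cstar hc ψ)

/-- The transform `ψ^{c*c}` agrees with `ψ` at indices with nonempty cell. -/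
theorem ctrans_cstar_eq {ψ : Fin N → ℝ} {x : X} {j : Fin N} (h : Attains c y ψ x j) :
    ctrans c y (cstar (X := X) c y ψ) j = ψ j := by
  have hle : ∀ x' : X, -c x' (y j) - cstar c y ψ x' ≤ ψ j := fun x' => by
    linarith [le_cstar (c := c) (y := y) ψ x' j]
  have : Nonempty X := ⟨x⟩
  refine le_antisymm (ciSup_le hle) ?_
  refine le_ciSup_of_le ⟨ψ j, Set.forall_mem_range.2 hle⟩ x ?_
  unfold Attains at h
  linarith

/-! ### Almost everywhere uniqueness of the maximizing index -/

/-- Two distinct maximizing indices `j`, `k` at `x` force `c(x, y_j) - c(x, y_k) = ψ k - ψ j`. On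
that level set the relative gradient `g j - g k` is nonzero by twist, so there are only finitely
many null sets to discard. -/
theorem ae_existsUnique_attains [Nonempty (Fin N)] (hX : IsCompact X)
    (hc : ∀ j, IsC1With X (fun x => c x (y j)) (g j)) (htwist : Twist X g) {μ : Measure X}
    (hμ : μ.map (Subtype.val : X → EuclideanSpace ℝ (Fin n)) ≪ volume) (ψ : Fin N → ℝ) :
    ∀ᵐ x ∂μ, ∃! j, Attains c y ψ x j := by
  have key : ∀ j k : Fin N, j ≠ k → ∀ᵐ x : X ∂μ, c x (y j) - c x (y k) ≠ ψ k - ψ j := by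
    intro j k hjk
    have hcl : IsClosed {x : X | c x (y j) - c x (y k) = ψ k - ψ j} :=
      isClosed_eq ((hc j).continuous_restrict.sub (hc k).continuous_restrict) continuous_const
    have hA : MeasurableSet
        ((Subtype.val : X → _) '' {x : X | c x (y j) - c x (y k) = ψ k - ψ j}) :=
      hX.measurableSet.subtype_image hcl.measurableSet
    have h0 := volume_eq_zero_of_hasGradientWithinAt_const hA (ψ k - ψ j)
      (fun x => g j x - g k x) ?_ ?_
    · have h1 := hμ h0
      rw [Measure.map_apply measurable_subtype_coe hA,
        Set.preimage_image_eq _ Subtype.val_injective] at h1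
      exact measure_eq_zero_iff_ae_notMem.1 h1
    · rintro _ ⟨x, hx, rfl⟩
      have h := ((hasGradientWithinAt_iff_hasFDerivWithinAt.1
        ((hc j).hasGradientWithinAt x x.2)).sub (hasGradientWithinAt_iff_hasFDerivWithinAt.1
        ((hc k).hasGradientWithinAt x x.2))).mono
          (Subtype.coe_image_subset X {x : X | c x (y j) - c x (y k) = ψ k - ψ j})
      rw [hasGradientWithinAt_iff_hasFDerivWithinAt, map_sub]
      refine h.congr ?_ ?_
      · rintro _ ⟨z, hz, rfl⟩
        exact hz.symm
      · exact hx.symm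
    · rintro _ ⟨x, -, rfl⟩ h
      exact htwist x x.2 j k hjk (by rw [sub_eq_zero.1 h])
  have hall : ∀ᵐ x : X ∂μ, ∀ j k : Fin N, j ≠ k → c x (y j) - c x (y k) ≠ ψ k - ψ j := by
    rw [ae_all_iff]
    intro j
    rw [ae_all_iff]
    intro k
    by_cases hjk : j = k
    · simp [hjk]
    · filter_upwards [key j k hjk] with x hx _ using hx
  filter_upwards [hall] with x hx
  obtain ⟨j, hj⟩ := exists_attains (c := c) (y := y) ψ x
  refine ⟨j, hj, fun k hk => ?_⟩
  by_contra hkj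
  refine hx k j hkj ?_
  unfold Attains at hj hk
  linarith

/-! ### Transport maps -/

variable {μ : Measure X} {ψ : Fin N → ℝ}

theorem IsMapOf.ae_attains {T : X → Y} (hT : IsMapOf c y ψ T)
    (hu : ∀ᵐ x ∂μ, ∃! j, Attains c y ψ x j) : ∀ᵐ x ∂μ, Attains c y ψ x (y.symm (T x)) := by
  filter_upwards [hu] with x ⟨j, hj, hj'⟩
  rw [hT x j hj hj']
  simpa using hj

theorem IsMapOf.ae_eq {T T' : X → Y} (hT : IsMapOf c y ψ T) (hT' : IsMapOf c y ψ T')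
    (hu : ∀ᵐ x ∂μ, ∃! j, Attains c y ψ x j) : T =ᵐ[μ] T' := by
  filter_upwards [hu] with x ⟨j, hj, hj'⟩
  rw [hT x j hj hj', hT' x j hj hj']

variable [MeasurableSpace Y]

theorem exists_measurable_isMapOf [Nonempty (Fin N)]
    (hc : ∀ j, Continuous fun x : X => c x (y j)) (ψ : Fin N → ℝ) :
    ∃ T : X → Y, Measurable T ∧ IsMapOf c y ψ T := by
  have : Countable Y := y.symm.injective.countable
  -- Breaking ties by the least index makes each fibre a closed cell minus finitely many closed
  -- cells, hence measurable.
  have hex : ∀ x : X, ∃ j, Attains c y ψ x j ∧ ∀ k < j, ¬ Attains c y ψ x k := by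
    intro x
    obtain ⟨j, hj, hmin⟩ := WellFounded.has_min (wellFounded_lt (α := Fin N))
      {j | Attains c y ψ x j} (exists_attains ψ x)
    exact ⟨j, hj, fun k hk hk' => hmin k hk' hk⟩
  choose J hJ hJmin using hex
  refine ⟨fun x => y (J x), measurable_to_countable' fun z => ?_, fun x j _ huniq => ?_⟩
  · have h : (fun x => y (J x)) ⁻¹' {z} = {x | Attains c y ψ x (y.symm z)} ∩
        ⋂ k, ⋂ (_ : k < y.symm z), {x | Attains c y ψ x k}ᶜ := by
      ext x
      simp only [Set.mem_preimage, Set.mem_singleton_iff, Set.mem_inter_iff, Set.mem_ofPred_eq,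
        Set.mem_iInter, Set.mem_compl_iff]
      constructor
      · rintro rfl
        simpa using ⟨hJ x, hJmin x⟩
      · rintro ⟨h1, h2⟩
        rw [← Equiv.eq_symm_apply]
        rcases lt_trichotomy (J x) (y.symm z) with h | h | h
        · exact absurd (hJ x) (h2 _ h)
        · exact h
        · exact absurd h1 (hJmin x _ h)
    rw [h]
    exact (isClosed_attains hc ψ _).measurableSet.inter <| MeasurableSet.iInter fun k =>
      MeasurableSet.iInter fun _ => (isClosed_attains hc ψ k).measurableSet.compl
  · exact congrArg y (huniq _ (hJ x))

variable [MeasurableSingletonClass Y]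

theorem targetMeasure_singleton (w : Fin N → ℝ) (j : Fin N) :
    targetMeasure y w {y j} = ENNReal.ofReal (w j) := by
  rw [targetMeasure, Measure.finsetSum_apply, Finset.sum_eq_single j]
  · simp
  · intro k _ hk
    simp [Measure.dirac_apply', hk]
  · simp

/-- The plan induced by a version of `T_ψ` couples `μ` with the masses of the cells of `ψ`. -/
theorem IsMapOf.map_mem_couplings [IsFiniteMeasure μ] {T : X → Y} (hT : IsMapOf c y ψ T)
    (hTm : Measurable T) (hu : ∀ᵐ x ∂μ, ∃! j, Attains c y ψ x j) {w : Fin N → ℝ}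
    (hw : CellMasses c y μ w ψ) :
    μ.map (fun x => (x, T x)) ∈ couplings μ (targetMeasure y w) := by
  have : Countable Y := y.symm.injective.countable
  have hm : Measurable fun x => (x, T x) := measurable_id.prodMk hTm
  refine ⟨?_, ?_⟩
  · rw [Measure.map_map measurable_fst hm]
    exact Measure.map_id
  · rw [Measure.map_map measurable_snd hm, Measure.ext_iff_singleton]
    intro z
    obtain ⟨j, rfl⟩ := y.surjective z
    rw [targetMeasure_singleton, hw j, ofReal_measureReal,
      Measure.map_apply (measurable_snd.comp hm)
        (measurableSet_singleton _)]
    refine measure_congr ?_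
    filter_upwards [hu, hT.ae_attains hu] with x ⟨k, _, hk'⟩ hx
    have h1 := hk' _ hx
    refine propext ⟨fun h => ?_, fun h => ?_⟩
    · change T x = y j at h
      rw [h, Equiv.symm_apply_apply] at hx
      exact hx
    · change T x = y j
      rw [← Equiv.symm_apply_eq, h1, hk' j h]

end

/-! ### Legendre transforms -/

section

variable {N : ℕ} {F : (Fin N → ℝ) → EReal}

theorem pairing_sub_left (v w ψ : Fin N → ℝ) :
    pairing (v - w) ψ = pairing v ψ - pairing w ψ := by
  simp [pairing, sub_mul, Finset.sum_sub_distrib]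

theorem pairing_add_right (w ψ ψ' : Fin N → ℝ) :
    pairing w (ψ + ψ') = pairing w ψ + pairing w ψ' := by
  simp [pairing, mul_add, Finset.sum_add_distrib]

theorem pairing_sub_right (w ψ ψ' : Fin N → ℝ) :
    pairing w (ψ - ψ') = pairing w ψ - pairing w ψ' := by
  simp [pairing, mul_sub, Finset.sum_sub_distrib]

theorem pairing_smul_right (w : Fin N → ℝ) (a : ℝ) (ψ : Fin N → ℝ) :
    pairing w (a • ψ) = a * pairing w ψ := by
  simp only [pairing, Pi.smul_apply, smul_eq_mul, Finset.mul_sum]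
  exact Finset.sum_congr rfl fun _ _ => by ring

theorem IsStorageFee.mem_weights (hF : IsStorageFee F) {v : Fin N → ℝ} (h : F v ≠ ⊤) :
    v ∈ weights N := by
  by_contra hv
  exact h (hF.eq_top v hv)

theorem IsStorageFee.exists_eq_coe (hF : IsStorageFee F) {v : Fin N → ℝ} (h : F v ≠ ⊤) :
    ∃ t : ℝ, F v = t :=
  ⟨(F v).toReal, (EReal.coe_toReal h (hF.ne_bot v)).symm⟩

theorem IsStorageFee.nonempty_fin (hF : IsStorageFee F) : Nonempty (Fin N) := by
  obtain ⟨v, hv⟩ := hF.proper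
  by_contra h
  rw [not_nonempty_iff] at h
  have := (hF.mem_weights hv).2
  simp at this

/-- Points where `F = ⊤` contribute `⊥` to the supremum, so only the real epigraph matters. Later
estimates on `F*` become linear inequalities over `ℝ`. -/
theorem IsStorageFee.legendre_le_iff (hF : IsStorageFee F) {ψ : Fin N → ℝ} {r : ℝ} :
    legendre F ψ ≤ r ↔ ∀ (v : Fin N → ℝ) (t : ℝ), F v ≤ t → pairing v ψ - t ≤ r := by
  rw [legendre, iSup_le_iff]
  refine forall_congr' fun v => ⟨fun h t ht => ?_, fun h => ?_⟩
  · rw [← EReal.coe_le_coe_iff, EReal.coe_sub]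
    exact (EReal.sub_le_sub le_rfl ht).trans h
  · by_cases hv : F v = ⊤
    · simp [hv]
    · obtain ⟨t, ht⟩ := hF.exists_eq_coe hv
      rw [ht, ← EReal.coe_sub, EReal.coe_le_coe_iff]
      exact h t ht.le

theorem IsStorageFee.legendre_ne_bot (hF : IsStorageFee F) (ψ : Fin N → ℝ) :
    legendre F ψ ≠ ⊥ := by
  obtain ⟨v, hv⟩ := hF.proper
  obtain ⟨t, ht⟩ := hF.exists_eq_coe hv
  intro h
  have h1 : ((pairing v ψ : ℝ) : EReal) - F v ≤ legendre F ψ :=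
    le_iSup (fun w => ((pairing w ψ : ℝ) : EReal) - F w) v
  rw [h, ht, ← EReal.coe_sub, le_bot_iff] at h1
  exact EReal.coe_ne_bot _ h1

theorem IsStorageFee.legendre_segment_le (hF : IsStorageFee F) {ψ ψ' : Fin N → ℝ} {r r' t : ℝ}
    (h : legendre F ψ ≤ r) (h' : legendre F ψ' ≤ r') (ht0 : 0 ≤ t) (ht1 : t ≤ 1) :
    legendre F (ψ + t • (ψ' - ψ)) ≤ ((1 - t) * r + t * r' : ℝ) := by
  rw [hF.legendre_le_iff] at *
  intro v s hs
  rw [pairing_add_right, pairing_smul_right, pairing_sub_right]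
  nlinarith [h v s hs, h' v s hs]

/-- A point of the subdifferential realizes equality in the Fenchel–Young inequality. -/
theorem IsStorageFee.legendre_eq_of_mem_subdiff (hF : IsStorageFee F) {w ψ : Fin N → ℝ}
    (h : ψ ∈ subdiff F w) : ∃ s : ℝ, F w = s ∧ legendre F ψ = (pairing w ψ - s : ℝ) := by
  have hw : F w ≠ ⊤ := by
    obtain ⟨v, hv⟩ := hF.proper
    intro hw
    have := h v
    rw [hw, EReal.top_add_coe, top_le_iff] at this
    exact hv this
  obtain ⟨s, hs⟩ := hF.exists_eq_coe hw
  refine ⟨s, hs, le_antisymm (hF.legendre_le_iff.2 fun v t ht => ?_) ?_⟩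
  · have := (h v).trans ht
    rw [hs, ← EReal.coe_add, EReal.coe_le_coe_iff, pairing_sub_left] at this
    linarith
  · rw [EReal.coe_sub, ← hs]
    exact le_iSup (fun v => ((pairing v ψ : ℝ) : EReal) - F v) w

theorem IsStorageFee.mem_subdiff_of_legendre_le (hF : IsStorageFee F) {w ψ : Fin N → ℝ} {s : ℝ}
    (hs : F w = s) (h : legendre F ψ ≤ (pairing w ψ - s : ℝ)) : ψ ∈ subdiff F w := by
  intro v
  by_cases hv : F v = ⊤
  · simp [hv]
  obtain ⟨t, ht⟩ := hF.exists_eq_coe hv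
  have := hF.legendre_le_iff.1 h v t ht.le
  rw [hs, ht, ← EReal.coe_add, EReal.coe_le_coe_iff, pairing_sub_left]
  linarith

theorem IsStorageFee.convex_epigraph (hF : IsStorageFee F) :
    Convex ℝ {p : (Fin N → ℝ) × ℝ | F p.1 ≤ p.2} := by
  rw [convex_iff_forall_pos]
  rintro ⟨v, s⟩ hs ⟨w, t⟩ ht a b ha hb hab
  refine (hF.convex v w a b ha hb hab).trans ?_
  change _ ≤ ((a * s + b * t : ℝ) : EReal)
  rw [EReal.coe_add, EReal.coe_mul, EReal.coe_mul]
  exact add_le_add (mul_le_mul_of_nonneg_left hs (EReal.coe_nonneg.2 ha.le))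
    (mul_le_mul_of_nonneg_left ht (EReal.coe_nonneg.2 hb.le))

/-- If `w` is a subgradient of `F*` at `ψ`, where `F* ψ ≤ r`, then `F` takes values below
`⟨w, ψ⟩ - r + ε` arbitrarily near `w`. -/
theorem IsStorageFee.mem_closure_epigraph (hF : IsStorageFee F) {w ψ : Fin N → ℝ} {r ε : ℝ}
    (hr : legendre F ψ ≤ r)
    (hmax : ∀ (ψ' : Fin N → ℝ) (r' : ℝ), legendre F ψ' ≤ r' →
      pairing w ψ' - r' ≤ pairing w ψ - r) (hε : 0 < ε) :
    (w, pairing w ψ - r + ε) ∈ closure {p : (Fin N → ℝ) × ℝ | F p.1 ≤ p.2} := by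
  by_contra hnot
  obtain ⟨f, u, hfu, hf⟩ := geometric_hahn_banach_point_closed hF.convex_epigraph.closure
    isClosed_closure hnot
  set q : Fin N → ℝ := fun j => f (Pi.single j 1, 0) with hq
  set s : ℝ := f (0, 1) with hs
  have hrep : ∀ (v : Fin N → ℝ) (t : ℝ), f (v, t) = pairing v q + s * t := by
    intro v t
    have h1 : (v, t) = ∑ j, v j • ((Pi.single j 1 : Fin N → ℝ), (0 : ℝ)) + t • (0, 1) := by
      refine Prod.ext ?_ ?_
      · simp only [Prod.fst_add, Prod.fst_sum, Prod.smul_fst, smul_zero, add_zero]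
        exact pi_eq_sum_univ' v
      · simp [Prod.snd_sum]
    rw [h1, map_add, map_sum, map_smul, smul_eq_mul, mul_comm t]
    simp only [map_smul, smul_eq_mul]
    rfl
  rw [hrep] at hfu
  have hepi : ∀ (v : Fin N → ℝ) (t : ℝ), F v ≤ t → u < pairing v q + s * t := by
    intro v t ht
    rw [← hrep]
    exact hf _ (subset_closure ht)
  -- The epigraph is unbounded upwards, so a negative vertical coefficient would violate the
  -- separation for large `t`.
  have hs0 : 0 ≤ s := by
    by_contra hneg
    push Not at hneg
    obtain ⟨v, hv⟩ := hF.proper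
    obtain ⟨t, ht⟩ := hF.exists_eq_coe hv
    have h1 := hepi v (max t ((u - pairing v q) / s))
      (ht.le.trans (EReal.coe_le_coe_iff.2 (le_max_left _ _)))
    have h2 := mul_le_mul_of_nonpos_left (le_max_right t ((u - pairing v q) / s)) hneg.le
    rw [mul_div_cancel₀ _ hneg.ne] at h2
    linarith
  -- For a vertical hyperplane, `⟨v, q⟩ > u` on the domain of `F`, so `F*(ψ - q) ≤ r - u`. The
  -- subgradient inequality then contradicts `⟨w, q⟩ < u`.
  rcases hs0.eq_or_lt with h0 | hpos
  · have h1 := hmax (ψ - q) (r - u) (hF.legendre_le_iff.2 fun v t ht => by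
      have := hF.legendre_le_iff.1 hr v t ht
      have := hepi v t ht
      rw [pairing_sub_right]
      rw [← h0] at this
      linarith)
    rw [pairing_sub_right] at h1
    rw [← h0] at hfu
    linarith
  -- Otherwise the hyperplane is the graph of an affine minorant of `F` with slope `-q/s`, so
  -- `F*(-q/s) ≤ -u/s`. At `w` this minorant exceeds `⟨w, ψ⟩ - r + ε`, against the subgradient
  -- inequality.
  · have h1 := hmax (-s⁻¹ • q) (-(s⁻¹ * u)) (hF.legendre_le_iff.2 fun v t ht => by
      have h2 := mul_lt_mul_of_pos_left (hepi v t ht) (inv_pos.2 hpos)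
      rw [mul_add, inv_mul_cancel_left₀ hpos.ne'] at h2
      rw [pairing_smul_right]
      linarith)
    have h2 := mul_lt_mul_of_pos_left hfu (inv_pos.2 hpos)
    rw [mul_add, inv_mul_cancel_left₀ hpos.ne'] at h2
    rw [pairing_smul_right] at h1
    linarith

end

/-! ### Couplings -/

section

variable {n N : ℕ} {X : Set (EuclideanSpace ℝ (Fin n))} {Y : Type*}
  {c : EuclideanSpace ℝ (Fin n) → Y → ℝ} {y : Fin N ≃ Y}
  {μ : Measure X} {w : Fin N → ℝ}

theorem exists_cost_bound [CompactSpace X] (hc : ∀ j, Continuous fun x : X => c x (y j)) :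
    ∃ M : ℝ, ∀ (x : X) (z : Y), |c x z| ≤ M := by
  have h : ∀ j, ∃ M : ℝ, ∀ x : X, |c x (y j)| ≤ M := fun j => by
    obtain ⟨M, hM⟩ := isCompact_univ.exists_bound_of_continuousOn (hc j).continuousOn
    exact ⟨M, fun x => hM x trivial⟩
  choose M hM using h
  refine ⟨∑ j, |M j|, fun x z => ?_⟩
  obtain ⟨j, rfl⟩ := y.surjective z
  exact (hM j x).trans ((le_abs_self _).trans
    (Finset.single_le_sum (f := fun j => |M j|) (fun k _ => abs_nonneg _) (Finset.mem_univ j)))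

theorem integrable_of_continuous [CompactSpace X] [IsFiniteMeasure μ] {φ : X → ℝ}
    (hφ : Continuous φ) : Integrable φ μ := by
  obtain ⟨M, hM⟩ := isCompact_univ.exists_bound_of_continuousOn hφ.continuousOn
  exact Integrable.of_bound hφ.measurable.aestronglyMeasurable M
    (Eventually.of_forall fun x => hM x trivial)

variable [MeasurableSpace Y]

theorem isProbabilityMeasure_targetMeasure (y : Fin N ≃ Y) (hw : w ∈ weights N) :
    IsProbabilityMeasure (targetMeasure y w) := by
  constructor
  simp only [targetMeasure, Measure.finsetSum_apply, Measure.smul_apply, measure_univ,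
    smul_eq_mul, mul_one]
  rw [← ENNReal.ofReal_sum_of_nonneg fun j _ => hw.1 j, hw.2, ENNReal.ofReal_one]

theorem isFiniteMeasure_of_mem_couplings [IsFiniteMeasure μ] {ν : Measure Y}
    {γ : Measure (X × Y)} (hγ : γ ∈ couplings μ ν) : IsFiniteMeasure γ := by
  constructor
  have h := congrArg (fun m => m Set.univ) hγ.1
  simp only [Measure.map_apply measurable_fst MeasurableSet.univ, Set.preimage_univ] at h
  rw [h]
  exact measure_lt_top μ _

theorem prod_mem_couplings [IsProbabilityMeasure μ] (ν : Measure Y) [IsProbabilityMeasure ν] :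
    μ.prod ν ∈ couplings μ ν :=
  ⟨by rw [Measure.map_fst_prod, measure_univ, one_smul],
    by rw [Measure.map_snd_prod, measure_univ, one_smul]⟩

variable [MeasurableSingletonClass Y]

theorem integral_targetMeasure (hw : w ∈ weights N) (ψ : Fin N → ℝ) :
    ∫ z, ψ (y.symm z) ∂(targetMeasure y w) = pairing w ψ := by
  have : Countable Y := y.symm.injective.countable
  rw [targetMeasure, integral_finsetSum_measure, pairing]
  · refine Finset.sum_congr rfl fun j _ => ?_
    rw [integral_smul_measure, integral_dirac, Equiv.symm_apply_apply,
      ENNReal.toReal_ofReal (hw.1 j), smul_eq_mul]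
  · exact fun j _ => (integrable_dirac (by simp)).smul_measure ENNReal.ofReal_ne_top

theorem measurable_cost (hc : ∀ j, Continuous fun x : X => c x (y j)) :
    Measurable fun p : X × Y => c p.1 p.2 := by
  have : Countable Y := y.symm.injective.countable
  refine measurable_from_prod_countable_left fun z => ?_
  obtain ⟨j, rfl⟩ := y.surjective z
  exact (hc j).measurable

theorem integrable_cost [CompactSpace X] (hc : ∀ j, Continuous fun x : X => c x (y j))
    (γ : Measure (X × Y)) [IsFiniteMeasure γ] : Integrable (fun p : X × Y => c p.1 p.2) γ := by
  obtain ⟨M, hM⟩ := exists_cost_bound hc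
  exact Integrable.of_bound (measurable_cost hc).aestronglyMeasurable M
    (Eventually.of_forall fun p => hM p.1 p.2)

theorem integrable_slack [CompactSpace X]
    (hc : ∀ j, Continuous fun x : X => c x (y j)) {φ : X → ℝ} (hφ : Continuous φ)
    (ψ : Fin N → ℝ) (γ : Measure (X × Y)) [IsFiniteMeasure γ] :
    Integrable (fun p : X × Y => c p.1 p.2 + φ p.1 + ψ (y.symm p.2)) γ :=
  -- `φ` is defined only on `X` while costs take arguments in the whole space, so it is extended by
  -- zero.
  integrable_cost (X := X) (y := y) (c := fun x z => c x z + Function.extend Subtype.val φ 0 x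
    + ψ (y.symm z)) (fun j => by
      simp only [Subtype.val_injective.extend_apply]
      exact ((hc j).add hφ).add continuous_const) γ |>.congr (Eventually.of_forall fun p => by
        simp only [Subtype.val_injective.extend_apply])

/-- This is the Kantorovich gap between `(φ, ψ)` and `γ`, computed from the marginals. Its sign
gives weak duality, and its vanishing gives complementary slackness. -/
theorem integral_slack [CompactSpace X] [IsFiniteMeasure μ]
    (hc : ∀ j, Continuous fun x : X => c x (y j)) {φ : X → ℝ} (hφ : Continuous φ)
    (ψ : Fin N → ℝ) (hw : w ∈ weights N) {γ : Measure (X × Y)}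
    (hγ : γ ∈ couplings μ (targetMeasure y w)) :
    ∫ p, (c p.1 p.2 + φ p.1 + ψ (y.symm p.2)) ∂γ
      = ∫ p, c p.1 p.2 ∂γ + ∫ x, φ x ∂μ + pairing w ψ := by
  have : Countable Y := y.symm.injective.countable
  have := isFiniteMeasure_of_mem_couplings hγ
  have h1 : Integrable (fun p : X × Y => φ p.1) γ :=
    Integrable.comp_measurable (f := Prod.fst) (g := φ)
      (by rw [hγ.1]; exact integrable_of_continuous hφ) measurable_fst
  have h2 : Integrable (fun p : X × Y => ψ (y.symm p.2)) γ :=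
    integrable_cost (y := y) (c := fun _ z => ψ (y.symm z)) (fun j => continuous_const) γ
  have h3 : Integrable (fun p : X × Y => c p.1 p.2 + φ p.1) γ := (integrable_cost hc γ).add h1
  rw [integral_add h3 h2, integral_add (integrable_cost hc γ) h1]
  congr 1
  · congr 1
    rw [← hγ.1, integral_map measurable_fst.aemeasurable hφ.measurable.aestronglyMeasurable]
  · rw [← integral_targetMeasure (y := y) hw ψ, ← hγ.2, integral_map measurable_snd.aemeasurable]
    exact (Measurable.of_discrete (f := fun z => ψ (y.symm z))).aestronglyMeasurable

/-- Mixing a coupling with a product measure. -/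
theorem exists_mixed_coupling [CompactSpace X] [IsProbabilityMeasure μ]
    (hc : ∀ j, Continuous fun x : X => c x (y j)) {M : ℝ} (hM : ∀ (x : X) (z : Y), |c x z| ≤ M)
    (hw : w ∈ weights N) {u : Fin N → ℝ} (hu : u ∈ weights N) {γ : Measure (X × Y)}
    (hγ : γ ∈ couplings μ (targetMeasure y w)) {δ : ℝ} (h0 : 0 ≤ δ) (h1 : δ ≤ 1) :
    ∃ γ' ∈ couplings μ (targetMeasure y ((1 - δ) • w + δ • u)),
      ∫ p, c p.1 p.2 ∂γ' ≤ (1 - δ) * ∫ p, c p.1 p.2 ∂γ + δ * M := by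
  have := isFiniteMeasure_of_mem_couplings hγ
  have := isProbabilityMeasure_targetMeasure y hu
  have hπ := prod_mem_couplings (μ := μ) (targetMeasure y u)
  have h1' : 0 ≤ 1 - δ := by linarith
  have hsum : ENNReal.ofReal (1 - δ) + ENNReal.ofReal δ = 1 := by
    rw [← ENNReal.ofReal_add h1' h0]
    simp
  refine ⟨ENNReal.ofReal (1 - δ) • γ + ENNReal.ofReal δ • μ.prod (targetMeasure y u),
    ⟨?_, ?_⟩, ?_⟩
  · rw [Measure.map_add _ _ measurable_fst, Measure.map_smul, Measure.map_smul, hγ.1, hπ.1,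
      ← add_smul, hsum, one_smul]
  · rw [Measure.map_add _ _ measurable_snd, Measure.map_smul, Measure.map_smul, hγ.2, hπ.2]
    simp only [targetMeasure, Finset.smul_sum, ← Finset.sum_add_distrib, smul_smul, ← add_smul]
    refine Finset.sum_congr rfl fun j _ => ?_
    rw [← ENNReal.ofReal_mul h1', ← ENNReal.ofReal_mul h0,
      ← ENNReal.ofReal_add (mul_nonneg h1' (hw.1 j)) (mul_nonneg h0 (hu.1 j))]
    rfl
  · rw [integral_add_measure ((integrable_cost hc γ).smul_measure ENNReal.ofReal_ne_top)
      ((integrable_cost hc _).smul_measure ENNReal.ofReal_ne_top), integral_smul_measure,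
      integral_smul_measure, ENNReal.toReal_ofReal h1', ENNReal.toReal_ofReal h0]
    simp only [smul_eq_mul]
    gcongr
    calc ∫ p, c p.1 p.2 ∂(μ.prod (targetMeasure y u))
        ≤ ∫ _p : X × Y, M ∂(μ.prod (targetMeasure y u)) :=
          integral_mono (integrable_cost hc _) (integrable_const _)
            fun p => (le_abs_self _).trans (hM p.1 p.2)
      _ = M := by simp

end

section

variable {n N : ℕ} {X : Set (EuclideanSpace ℝ (Fin n))} {Y : Type*}
  {c : EuclideanSpace ℝ (Fin n) → Y → ℝ} {y : Fin N ≃ Y}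

variable {F : (Fin N → ℝ) → EReal} {μ : Measure X} {w ψ : Fin N → ℝ}

/-! ### The objectives in terms of real numbers -/

theorem DualAdmissible.slack_nonneg {φ : X → ℝ} (h : DualAdmissible c y φ ψ) (p : X × Y) :
    0 ≤ c p.1 p.2 + φ p.1 + ψ (y.symm p.2) := by
  have := h.2 p.1 (y.symm p.2)
  rw [Equiv.apply_symm_apply] at this
  linarith

/-- The dual objective at a maximizer, in terms of real numbers. -/
theorem IsDualMaximizer.exists_real [Nonempty (Fin N)] (hF : IsStorageFee F)
    (hc : ∀ j, Continuous fun x : X => c x (y j)) {φ : X → ℝ}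
    (h : IsDualMaximizer c y F μ φ ψ) {ψ₀ : Fin N → ℝ} {r₀ : ℝ} (h₀ : legendre F ψ₀ ≤ r₀) :
    ∃ r : ℝ, legendre F ψ = r ∧ ∀ (φ' : X → ℝ) (ψ' : Fin N → ℝ) (r' : ℝ),
      DualAdmissible c y φ' ψ' → legendre F ψ' ≤ r' →
        -∫ x, φ' x ∂μ - r' ≤ -∫ x, φ x ∂μ - r := by
  have hle : ∀ (φ' : X → ℝ) (ψ' : Fin N → ℝ) (r' : ℝ), DualAdmissible c y φ' ψ' →
      legendre F ψ' ≤ r' → ((-∫ x, φ' x ∂μ - r' : ℝ) : EReal) ≤ dualValue F μ φ ψ := by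
    intro φ' ψ' r' hadm hr'
    refine le_trans ?_ (h.2 φ' ψ' hadm)
    rw [EReal.coe_sub]
    exact EReal.sub_le_sub le_rfl hr'
  -- An infinite `F*(ψ)` would make the dual value `⊥`, below the finite bound supplied by
  -- `(ψ₀^{c*}, ψ₀)`.
  have htop : legendre F ψ ≠ ⊤ := by
    intro htop
    have h1 := hle _ _ _ (dualAdmissible_cstar hc ψ₀) h₀
    rw [dualValue, htop, EReal.sub_top, le_bot_iff] at h1
    exact EReal.coe_ne_bot _ h1
  refine ⟨(legendre F ψ).toReal, (EReal.coe_toReal htop (hF.legendre_ne_bot ψ)).symm,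
    fun φ' ψ' r' hadm hr' => ?_⟩
  have h1 := hle φ' ψ' r' hadm hr'
  rwa [dualValue, ← EReal.coe_toReal htop (hF.legendre_ne_bot ψ), ← EReal.coe_sub,
    EReal.coe_le_coe_iff] at h1

section

variable [MeasurableSpace Y]

/-- The primal objective at a minimizer, in terms of real numbers. -/
theorem IsPrimalMinimizer.exists_real [IsProbabilityMeasure μ]
    (hF : IsStorageFee F) {γ : Measure (X × Y)} (h : IsPrimalMinimizer c y F μ γ w) :
    ∃ s : ℝ, F w = s ∧ ∀ v ∈ weights N, ∀ t : ℝ, F v ≤ t →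
      ∀ γ' ∈ couplings μ (targetMeasure y v),
        ∫ p, c p.1 p.2 ∂γ + s ≤ ∫ p, c p.1 p.2 ∂γ' + t := by
  have hw : F w ≠ ⊤ := by
    obtain ⟨v, hv⟩ := hF.proper
    obtain ⟨t, ht⟩ := hF.exists_eq_coe hv
    have := isProbabilityMeasure_targetMeasure y (hF.mem_weights hv)
    intro hw
    have h1 := h.2.2 v (hF.mem_weights hv) _ (prod_mem_couplings (targetMeasure y v))
    rw [primalValue, primalValue, hw, ht, EReal.coe_add_top, top_le_iff, ← EReal.coe_add] at h1
    exact EReal.coe_ne_top _ h1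
  obtain ⟨s, hs⟩ := hF.exists_eq_coe hw
  refine ⟨s, hs, fun v hv t ht γ' hγ' => ?_⟩
  have h1 := (h.2.2 v hv γ' hγ').trans (add_le_add_right ht _)
  rwa [primalValue, hs, ← EReal.coe_add, ← EReal.coe_add, EReal.coe_le_coe_iff] at h1

end

/-! ### Differentiability of `ψ ↦ ∫ ψ^{c*} dμ` -/

theorem cstar_add_le [Nonempty (Fin N)] (ψ h : Fin N → ℝ) (x : X) :
    cstar c y (ψ + h) x ≤ cstar c y ψ x + ∑ j, |h j| := by
  refine cstar_le fun j => ?_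
  have h1 := le_cstar (c := c) (y := y) ψ x j
  have h2 := Finset.single_le_sum (f := fun j => |h j|) (fun k _ => abs_nonneg _)
    (Finset.mem_univ j)
  have h3 := neg_abs_le (h j)
  simp only [Pi.add_apply]
  linarith

/-- The lower bound is the upper one applied to the shift `-h` from `ψ + h`. The bound is uniform in
`x` and dominates the difference quotients below. -/
theorem abs_cstar_add_sub_le [Nonempty (Fin N)] (ψ h : Fin N → ℝ) (x : X) :
    |cstar c y (ψ + h) x - cstar c y ψ x| ≤ ∑ j, |h j| := by
  have h1 := cstar_add_le (c := c) (y := y) ψ h x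
  have h2 := cstar_add_le (c := c) (y := y) (ψ + h) (-h) x
  simp only [add_neg_cancel_right, Pi.neg_apply, abs_neg] at h2
  rw [abs_le]
  constructor <;> linarith

/-- Where the maximizing index is unique, `ψ^{c*}` is affine in `ψ` along short segments. -/
theorem eventually_cstar_add_smul [Nonempty (Fin N)] {ψ : Fin N → ℝ} {x : X} {j : Fin N}
    (hj : Attains c y ψ x j) (huniq : ∀ k, Attains c y ψ x k → k = j) (h : Fin N → ℝ) :
    ∀ᶠ t : ℝ in 𝓝 0, cstar c y (ψ + t • h) x = cstar c y ψ x - t * h j := by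
  have hk : ∀ k, ∀ᶠ t : ℝ in 𝓝 0,
      -c x (y k) - (ψ k + t * h k) ≤ -c x (y j) - (ψ j + t * h j) := by
    intro k
    by_cases hkj : k = j
    · simp [hkj]
    have hlt : -c x (y k) - ψ k < -c x (y j) - ψ j :=
      lt_of_le_of_ne (hj.symm ▸ le_cstar ψ x k) fun heq => hkj (huniq k (heq.trans hj))
    have hcont : ∀ i, Continuous fun t : ℝ => -c x (y i) - (ψ i + t * h i) := fun i => by fun_prop
    have := (hcont k).continuousAt.eventually_lt (hcont j).continuousAt (x₀ := (0 : ℝ))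
      (by simpa using hlt)
    exact this.mono fun t ht => ht.le
  filter_upwards [eventually_all.2 hk] with t ht
  unfold Attains at hj
  have hval : cstar c y (ψ + t • h) x = -c x (y j) - (ψ j + t * h j) :=
    le_antisymm (cstar_le ht) (le_cstar (c := c) (y := y) (ψ + t • h) x j)
  rw [hval, ← hj]
  ring

variable [MeasurableSpace Y] [MeasurableSingletonClass Y]

theorem IsMapOf.integral_comp [IsFiniteMeasure μ] {T : X → Y} (hT : IsMapOf c y ψ T)
    (hTm : Measurable T) (hu : ∀ᵐ x ∂μ, ∃! j, Attains c y ψ x j) (hw : w ∈ weights N)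
    (hcell : CellMasses c y μ w ψ) (h : Fin N → ℝ) :
    ∫ x, h (y.symm (T x)) ∂μ = pairing w h := by
  have : Countable Y := y.symm.injective.countable
  have hm : Measurable fun x => (x, T x) := measurable_id.prodMk hTm
  rw [← integral_targetMeasure (y := y) hw h, ← (hT.map_mem_couplings hTm hu hcell).2,
    Measure.map_map measurable_snd hm]
  exact (integral_map hTm.aemeasurable
    (Measurable.of_discrete (f := fun z => h (y.symm z))).aestronglyMeasurable).symm

/-- For almost every `x` the quotient eventually equals `-h j`, with `j` the unique maximizing
index. Dominated convergence and the cell masses then give the limit. -/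
theorem tendsto_integral_cstar_slope [Nonempty (Fin N)] [CompactSpace X] [IsFiniteMeasure μ]
    (hc : ∀ j, Continuous fun x : X => c x (y j)) (hu : ∀ᵐ x ∂μ, ∃! j, Attains c y ψ x j)
    (hw : w ∈ weights N) (hcell : CellMasses c y μ w ψ) (h : Fin N → ℝ) :
    Tendsto (fun t : ℝ => t⁻¹ * (∫ x, cstar c y (ψ + t • h) x ∂μ - ∫ x, cstar c y ψ x ∂μ))
      (𝓝[>] 0) (𝓝 (-pairing w h)) := by
  obtain ⟨T, hTm, hT⟩ := exists_measurable_isMapOf (X := X) hc ψ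
  have hlim : Tendsto
      (fun t : ℝ => ∫ x, t⁻¹ * (cstar c y (ψ + t • h) x - cstar c y ψ x) ∂μ)
      (𝓝[>] 0) (𝓝 (∫ x, -h (y.symm (T x)) ∂μ)) := by
    refine tendsto_integral_filter_of_dominated_convergence (fun _ => ∑ j, |h j|) ?_ ?_
      (integrable_const _) ?_
    · exact Eventually.of_forall fun t => (continuous_const.mul ((continuous_cstar hc _).sub
        (continuous_cstar hc _))).measurable.aestronglyMeasurable
    · filter_upwards [self_mem_nhdsWithin] with t ht
      refine Eventually.of_forall fun x => ?_
      have ht' : (0 : ℝ) < t := ht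
      have h1 := abs_cstar_add_sub_le (c := c) (y := y) ψ (t • h) x
      simp only [Pi.smul_apply, smul_eq_mul, abs_mul, abs_of_pos ht', ← Finset.mul_sum] at h1
      rw [Real.norm_eq_abs, abs_mul, abs_of_pos (inv_pos.2 ht'), inv_mul_le_iff₀ ht']
      exact h1
    · filter_upwards [hu] with x ⟨j, hj, huniq⟩
      rw [hT x j hj huniq, Equiv.symm_apply_apply]
      refine tendsto_const_nhds.congr' ?_
      filter_upwards [self_mem_nhdsWithin,
        nhdsWithin_le_nhds (eventually_cstar_add_smul hj huniq h)] with t ht hval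
      have ht' : t ≠ 0 := ne_of_gt ht
      rw [hval]
      field_simp
      ring
  rw [integral_neg, hT.integral_comp hTm hu hw hcell h] at hlim
  refine hlim.congr fun t => ?_
  rw [integral_const_mul, integral_sub (integrable_of_continuous (continuous_cstar hc _))
    (integrable_of_continuous (continuous_cstar hc _))]

/-- Almost everywhere uniqueness rules out double counting: `ν_w` is the image of `μ` under a
version of `T_ψ`, so its total mass is 1. -/
theorem cellMasses_mem_weights [Nonempty (Fin N)] [IsProbabilityMeasure μ]
    (hc : ∀ j, Continuous fun x : X => c x (y j)) (hu : ∀ᵐ x ∂μ, ∃! j, Attains c y ψ x j)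
    (hcell : CellMasses c y μ w ψ) : w ∈ weights N := by
  obtain ⟨T, hTm, hT⟩ := exists_measurable_isMapOf (X := X) hc ψ
  have hw0 : ∀ j, 0 ≤ w j := fun j => hcell j ▸ measureReal_nonneg
  refine ⟨hw0, ?_⟩
  have h1 := (hT.map_mem_couplings hTm hu hcell).2
  have hm : Measurable fun x => (x, T x) := measurable_id.prodMk hTm
  rw [Measure.map_map measurable_snd hm] at h1
  have h2 : targetMeasure y w Set.univ = 1 := by
    rw [← h1, Measure.map_apply (measurable_snd.comp hm) MeasurableSet.univ,
      Set.preimage_univ, measure_univ]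
  simp only [targetMeasure, Measure.finsetSum_apply, Measure.smul_apply, measure_univ,
    smul_eq_mul, mul_one] at h2
  rwa [← ENNReal.ofReal_sum_of_nonneg fun j _ => hw0 j, ENNReal.ofReal_eq_one] at h2

/-! ### Duality -/

/-- Weak Kantorovich duality. -/
theorem DualAdmissible.le_integral_cost [CompactSpace X] [IsFiniteMeasure μ]
    (hc : ∀ j, Continuous fun x : X => c x (y j)) {φ : X → ℝ} (h : DualAdmissible c y φ ψ)
    (hw : w ∈ weights N) {γ : Measure (X × Y)} (hγ : γ ∈ couplings μ (targetMeasure y w)) :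
    -∫ x, φ x ∂μ - pairing w ψ ≤ ∫ p, c p.1 p.2 ∂γ := by
  have h1 := integral_slack hc h.1 ψ hw hγ
  have h2 : 0 ≤ ∫ p, (c p.1 p.2 + φ p.1 + ψ (y.symm p.2)) ∂γ :=
    integral_nonneg h.slack_nonneg
  linarith

/-- The plan induced by `T_ψ` and the pair `(ψ^{c*}, ψ)` have the same Kantorovich value. -/
theorem IsMapOf.integral_cost [Nonempty (Fin N)] [CompactSpace X] [IsFiniteMeasure μ]
    (hc : ∀ j, Continuous fun x : X => c x (y j)) {T : X → Y} (hT : IsMapOf c y ψ T)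
    (hTm : Measurable T) (hu : ∀ᵐ x ∂μ, ∃! j, Attains c y ψ x j) (hw : w ∈ weights N)
    (hcell : CellMasses c y μ w ψ) :
    ∫ p, c p.1 p.2 ∂(μ.map fun x => (x, T x)) = -∫ x, cstar c y ψ x ∂μ - pairing w ψ := by
  have hm : Measurable fun x => (x, T x) := measurable_id.prodMk hTm
  have h1 := integral_slack hc (continuous_cstar hc ψ) ψ hw (hT.map_mem_couplings hTm hu hcell)
  rw [integral_map hm.aemeasurable (integrable_slack hc (continuous_cstar hc ψ) ψ
    (μ.map fun x => (x, T x))).aestronglyMeasurable, integral_eq_zero_of_ae] at h1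
  · linarith
  · filter_upwards [hT.ae_attains hu] with x hx
    unfold Attains at hx
    rw [Equiv.apply_symm_apply] at hx
    simp only [Pi.zero_apply]
    linarith

/-- The masses of the cells of a dual maximizer `ψ` form a subgradient of `F*` at `ψ`. -/
theorem pairing_sub_le_of_dual_maximal [Nonempty (Fin N)] [CompactSpace X] [IsFiniteMeasure μ]
    (hF : IsStorageFee F) (hc : ∀ j, Continuous fun x : X => c x (y j))
    (hu : ∀ᵐ x ∂μ, ∃! j, Attains c y ψ x j) (hw : w ∈ weights N)
    (hcell : CellMasses c y μ w ψ) {r : ℝ} (hr : legendre F ψ ≤ r)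
    (hmax : ∀ (ψ' : Fin N → ℝ) (r' : ℝ), legendre F ψ' ≤ r' →
      -∫ x, cstar c y ψ' x ∂μ - r' ≤ -∫ x, cstar c y ψ x ∂μ - r)
    {ψ' : Fin N → ℝ} {r' : ℝ} (hr' : legendre F ψ' ≤ r') :
    pairing w ψ' - r' ≤ pairing w ψ - r := by
  have hlim := tendsto_integral_cstar_slope hc hu hw hcell (ψ' - ψ)
  have h1 : r - r' ≤ -pairing w (ψ' - ψ) := by
    refine ge_of_tendsto hlim ?_
    filter_upwards [Ioo_mem_nhdsGT one_pos] with t ht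
    -- Optimality against `ψ + t(ψ' - ψ)`, with `F*` bounded by convexity, shows that the increment
    -- of `∫ ψ^{c*} dμ` is at least `t (r - r')`.
    have h2 := hmax _ _ (hF.legendre_segment_le hr hr' ht.1.le ht.2.le)
    rw [← mul_le_mul_iff_right₀ ht.1, mul_inv_cancel_left₀ ht.1.ne']
    linarith
  rw [pairing_sub_right] at h1
  linarith

/-- A weight vector `v` close to `w` is a mixture of `w` and some weight vector, with most of the
mass on `w`. -/
theorem eventually_exists_mixture (hw : w ∈ weights N) {δ : ℝ} (h0 : 0 < δ) :
    ∀ᶠ v in 𝓝 w, v ∈ weights N → ∃ u ∈ weights N, v = (1 - δ) • w + δ • u := by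
  have hev : ∀ j, ∀ᶠ v : Fin N → ℝ in 𝓝 w, v ∈ weights N → (1 - δ) * w j ≤ v j := by
    intro j
    rcases (hw.1 j).eq_or_lt with hj | hj
    · exact Eventually.of_forall fun v hv => by simpa [← hj] using hv.1 j
    · have : ∀ᶠ v : Fin N → ℝ in 𝓝 w, (1 - δ) * w j < v j :=
        (continuous_apply j).continuousAt.eventually_const_lt (by nlinarith)
      exact this.mono fun v hv _ => hv.le
  filter_upwards [eventually_all.2 hev] with v hv hvw
  refine ⟨δ⁻¹ • (v - (1 - δ) • w), ⟨fun j => ?_, ?_⟩, ?_⟩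
  · have := hv j hvw
    simp only [Pi.smul_apply, Pi.sub_apply, smul_eq_mul]
    exact mul_nonneg (inv_nonneg.2 h0.le) (by linarith)
  · simp only [Pi.smul_apply, Pi.sub_apply, smul_eq_mul, ← Finset.mul_sum,
      Finset.sum_sub_distrib, hvw.2, hw.2]
    field_simp
    ring
  · rw [smul_inv_smul₀ h0.ne']
    abel

/-- Absence of a duality gap: if the primal objective is bounded below by `P`, then so is the
value at `(γ, w)` of the primal objective for the closure of `F`. -/
theorem primal_bound_le [CompactSpace X] [IsProbabilityMeasure μ] (hF : IsStorageFee F)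
    (hc : ∀ j, Continuous fun x : X => c x (y j)) (hw : w ∈ weights N) {γ : Measure (X × Y)}
    (hγ : γ ∈ couplings μ (targetMeasure y w)) {P a : ℝ}
    (hP : ∀ v ∈ weights N, ∀ t : ℝ, F v ≤ t → ∀ γ' ∈ couplings μ (targetMeasure y v),
      P ≤ ∫ p, c p.1 p.2 ∂γ' + t)
    (ha : ∀ ε > 0, (w, a + ε) ∈ closure {p : (Fin N → ℝ) × ℝ | F p.1 ≤ p.2}) :
    P ≤ ∫ p, c p.1 p.2 ∂γ + a := by
  obtain ⟨M, hM⟩ := exists_cost_bound (X := X) hc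
  -- `F w` itself may exceed `a`. An epigraph point near `(w, a + δ)` has fee below `a + 2δ`, and
  -- mixing `γ` with a product plan costs at most `δ * M` more than `(1 - δ)` times the cost of `γ`.
  have key : ∀ δ : ℝ, 0 < δ → δ < 1 →
      P ≤ (1 - δ) * ∫ p, c p.1 p.2 ∂γ + δ * M + (a + 2 * δ) := by
    intro δ h0 h1
    have hnear : ∀ᶠ p : (Fin N → ℝ) × ℝ in 𝓝 (w, a + δ),
        (p.1 ∈ weights N → ∃ u ∈ weights N, p.1 = (1 - δ) • w + δ • u) ∧ p.2 < a + 2 * δ :=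
      (continuous_fst.continuousAt.eventually (eventually_exists_mixture hw h0)).and
        ((continuous_snd.tendsto (w, a + δ)).eventually_lt_const
          (show a + δ < a + 2 * δ by linarith))
    obtain ⟨⟨v, t⟩, hvt, hmix, hlt⟩ :=
      ((mem_closure_iff_frequently.1 (ha δ h0)).and_eventually hnear).exists
    have hv : v ∈ weights N :=
      hF.mem_weights fun h => (EReal.coe_ne_top t) (top_le_iff.1 (h ▸ hvt))
    obtain ⟨u, hu, rfl⟩ := hmix hv
    obtain ⟨γ', hγ', hle⟩ := exists_mixed_coupling hc hM hw hu hγ h0.le h1.le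
    have := hP _ hv t hvt γ' hγ'
    simp only at hlt
    linarith
  have hlim : Tendsto (fun δ : ℝ => (1 - δ) * ∫ p, c p.1 p.2 ∂γ + δ * M + (a + 2 * δ))
      (𝓝[>] 0) (𝓝 ((1 - 0) * ∫ p, c p.1 p.2 ∂γ + 0 * M + (a + 2 * 0))) :=
    Continuous.tendsto (f := fun δ : ℝ => (1 - δ) * ∫ p, c p.1 p.2 ∂γ + δ * M + (a + 2 * δ))
      (by fun_prop) 0 |>.mono_left nhdsWithin_le_nhds
  simp only [sub_zero, one_mul, zero_mul, add_zero, mul_zero] at hlim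
  refine ge_of_tendsto hlim ?_
  filter_upwards [Ioo_mem_nhdsGT one_pos] with δ hδ using key δ hδ.1 hδ.2

/-- Strong duality: a dual maximizer and a primal minimizer satisfy equality in the Fenchel–Young
inequality, and the plan is concentrated where the dual constraint is active. -/
theorem complementary_slackness [Nonempty (Fin N)] [CompactSpace X] [IsProbabilityMeasure μ]
    (hF : IsStorageFee F) (hc : ∀ j, Continuous fun x : X => c x (y j)) {φ : X → ℝ}
    {γ : Measure (X × Y)} (hu : ∀ᵐ x ∂μ, ∃! j, Attains c y ψ x j)
    (hd : IsDualMaximizer c y F μ φ ψ) (hp : IsPrimalMinimizer c y F μ γ w) :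
    ψ ∈ subdiff F w ∧ ∀ᵐ p ∂γ, Attains c y ψ p.1 (y.symm p.2) := by
  have hγfin := isFiniteMeasure_of_mem_couplings hp.2.1
  obtain ⟨s, hs, hP⟩ := hp.exists_real hF
  obtain ⟨M, hM⟩ := exists_cost_bound (X := X) hc
  -- Product plans cost at most `M`, so `F` is bounded below by the primal minimum minus `M`. This
  -- supplies a dual competitor of finite value.
  have hbdd : legendre F 0 ≤ (M - (∫ p, c p.1 p.2 ∂γ + s) : ℝ) := by
    refine hF.legendre_le_iff.2 fun v t ht => ?_
    have hv : v ∈ weights N :=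
      hF.mem_weights fun h => (EReal.coe_ne_top t) (top_le_iff.1 (h ▸ ht))
    have := isProbabilityMeasure_targetMeasure y hv
    have h1 := hP v hv t ht _ (prod_mem_couplings (targetMeasure y v))
    have h2 : ∫ p, c p.1 p.2 ∂(μ.prod (targetMeasure y v)) ≤ M :=
      calc ∫ p, c p.1 p.2 ∂(μ.prod (targetMeasure y v))
          ≤ ∫ _p : X × Y, M ∂(μ.prod (targetMeasure y v)) :=
            integral_mono (integrable_cost hc _) (integrable_const _)
              fun p => (le_abs_self _).trans (hM p.1 p.2)
        _ = M := by simp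
    simp only [pairing, Pi.zero_apply, mul_zero, Finset.sum_const_zero]
    linarith
  obtain ⟨r, hr, hD⟩ := hd.exists_real hF hc hbdd
  have hφ : ∫ x, cstar c y ψ x ∂μ ≤ ∫ x, φ x ∂μ :=
    integral_mono (integrable_of_continuous (continuous_cstar hc ψ))
      (integrable_of_continuous hd.1.1) hd.1.cstar_le
  set w' : Fin N → ℝ := fun j => μ.real {x : X | -c x (y j) - ψ j = cstar c y ψ x}
  have hcell : CellMasses c y μ w' ψ := fun j => rfl
  have hw' := cellMasses_mem_weights hc hu hcell
  obtain ⟨T, hTm, hT⟩ := exists_measurable_isMapOf (X := X) hc ψ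
  -- Once `hval` is inserted, the right side is `-∫ ψ^{c*} dμ - r`, so the primal minimum is at most
  -- the dual maximum.
  have hgap : ∫ p, c p.1 p.2 ∂γ + s
      ≤ ∫ p, c p.1 p.2 ∂(μ.map fun x => (x, T x)) + (pairing w' ψ - r) := by
    refine primal_bound_le hF hc hw' (hT.map_mem_couplings hTm hu hcell) hP fun ε hε => ?_
    refine hF.mem_closure_epigraph hr.le (fun ψ' r' hr' => ?_) hε
    refine pairing_sub_le_of_dual_maximal hF hc hu hw' hcell hr.le (fun ψ'' r'' h'' => ?_) hr'
    have := hD _ ψ'' r'' (dualAdmissible_cstar hc ψ'') h''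
    linarith
  have hval := hT.integral_cost hc hTm hu hw' hcell
  have hopt := hD _ ψ r (dualAdmissible_cstar hc ψ) hr.le
  have hFY := hF.legendre_le_iff.1 hr.le w s hs.le
  have hslack := integral_slack hc hd.1.1 ψ hp.1 hp.2.1
  have hnonneg : 0 ≤ ∫ p, (c p.1 p.2 + φ p.1 + ψ (y.symm p.2)) ∂γ :=
    integral_nonneg hd.1.slack_nonneg
  -- By `hgap` and `hopt`, the slack integral plus the deficit `s + r - ⟨w, ψ⟩` is at most 0. Both
  -- terms are nonnegative, so both vanish.
  refine ⟨hF.mem_subdiff_of_legendre_le hs ?_, ?_⟩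
  · rw [hr, EReal.coe_le_coe_iff]
    linarith
  · have h0 : ∫ p, (c p.1 p.2 + φ p.1 + ψ (y.symm p.2)) ∂γ = 0 := by linarith
    rw [integral_eq_zero_iff_of_nonneg hd.1.slack_nonneg
      (integrable_slack hc hd.1.1 ψ γ)] at h0
    filter_upwards [h0] with p hp0
    -- Zero slack squeezes `ψ^{c*}(x) ≤ φ(x) = -c(x, y_j) - ψ j ≤ ψ^{c*}(x)`.
    have h1 := hd.1.cstar_le p.1
    have h2 := le_cstar (c := c) (y := y) ψ p.1 (y.symm p.2)
    simp only [Pi.zero_apply] at hp0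
    unfold Attains
    rw [Equiv.apply_symm_apply] at h2 ⊢
    linarith

/-- A plan concentrated on the graph of the maximizing index transports the masses of the
cells. -/
theorem cellMasses_of_ae_attains [Nonempty (Fin N)] [IsFiniteMeasure μ]
    (hc : ∀ j, Continuous fun x : X => c x (y j)) (hu : ∀ᵐ x ∂μ, ∃! j, Attains c y ψ x j)
    (hw : w ∈ weights N) {γ : Measure (X × Y)} (hγ : γ ∈ couplings μ (targetMeasure y w))
    (hatt : ∀ᵐ p ∂γ, Attains c y ψ p.1 (y.symm p.2)) : CellMasses c y μ w ψ := by
  intro j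
  have hu' : ∀ᵐ p ∂γ, ∃! j, Attains c y ψ p.1 j := by
    rw [← hγ.1] at hu
    exact ae_of_ae_map measurable_fst.aemeasurable hu
  have h1 : γ (Prod.snd ⁻¹' {y j}) = ENNReal.ofReal (w j) := by
    rw [← Measure.map_apply measurable_snd (measurableSet_singleton _), hγ.2,
      targetMeasure_singleton]
  have h2 : γ (Prod.fst ⁻¹' {x : X | Attains c y ψ x j}) = μ {x : X | Attains c y ψ x j} := by
    rw [← Measure.map_apply measurable_fst (isClosed_attains hc ψ j).measurableSet, hγ.1]
  have h3 : γ (Prod.snd ⁻¹' {y j}) = γ (Prod.fst ⁻¹' {x : X | Attains c y ψ x j}) := by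
    refine measure_congr ?_
    filter_upwards [hu', hatt] with p ⟨k, _, hk⟩ hp
    refine propext ⟨fun h => ?_, fun h => ?_⟩
    · change p.2 = y j at h
      rw [h, Equiv.symm_apply_apply] at hp
      exact hp
    · change p.2 = y j
      rw [← Equiv.symm_apply_eq, hk _ hp, hk j h]
  change w j = (μ {x : X | Attains c y ψ x j}).toReal
  rw [← h2, ← h3, h1, ENNReal.toReal_ofReal (hw.1 j)]

/-- Equality in Fenchel–Young and the mass balance make `(ψ^{c*}, ψ)` and the plan induced by
`T_ψ` optimal. -/
theorem optimal_of_mem_subdiff [Nonempty (Fin N)] [CompactSpace X] [IsProbabilityMeasure μ]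
    (hF : IsStorageFee F) (hc : ∀ j, Continuous fun x : X => c x (y j))
    (hu : ∀ᵐ x ∂μ, ∃! j, Attains c y ψ x j) (hw : w ∈ weights N) (hψ : ψ ∈ subdiff F w)
    (hcell : CellMasses c y μ w ψ) {T : X → Y} (hT : IsMapOf c y ψ T) (hTm : Measurable T) :
    IsDualMaximizer c y F μ (cstar c y ψ) ψ ∧
      IsPrimalMinimizer c y F μ (μ.map fun x => (x, T x)) w := by
  obtain ⟨s, hs, hleg⟩ := hF.legendre_eq_of_mem_subdiff hψ
  have hγ := hT.map_mem_couplings hTm hu hcell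
  have hval := hT.integral_cost hc hTm hu hw hcell
  refine ⟨⟨dualAdmissible_cstar hc ψ, fun φ' ψ' hadm => ?_⟩, hw, hγ, fun v hv γ' hγ' => ?_⟩
  · have h1 := hadm.le_integral_cost hc hw hγ
    have h2 : ((pairing w ψ' - s : ℝ) : EReal) ≤ legendre F ψ' := by
      rw [EReal.coe_sub, ← hs]
      exact le_iSup (fun v => ((pairing v ψ' : ℝ) : EReal) - F v) w
    calc dualValue F μ φ' ψ' ≤ ((-∫ x, φ' x ∂μ : ℝ) : EReal) - (pairing w ψ' - s : ℝ) :=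
          EReal.sub_le_sub le_rfl h2
      _ ≤ dualValue F μ (cstar c y ψ) ψ := by
          rw [dualValue, hleg, ← EReal.coe_sub, ← EReal.coe_sub, EReal.coe_le_coe_iff]
          linarith
  · by_cases hFv : F v = ⊤
    · rw [primalValue, primalValue, hFv, EReal.coe_add_top]
      exact le_top
    obtain ⟨t, ht⟩ := hF.exists_eq_coe hFv
    have h1 := (dualAdmissible_cstar hc ψ).le_integral_cost hc hv hγ'
    have h2 := hF.legendre_le_iff.1 hleg.le v t ht.le
    rw [primalValue, primalValue, hs, ht, ← EReal.coe_add, ← EReal.coe_add,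
      EReal.coe_le_coe_iff]
    linarith

end

end StorageFees

/-! ### Necessity and sufficiency of the optimality conditions -/

theorem mainTheorem1 {n N : ℕ} (X : Set (EuclideanSpace ℝ (Fin n))) (hX : IsCompact X)
    {Y : Type*} [MeasurableSpace Y] [MeasurableSingletonClass Y] (y : Fin N ≃ Y)
    (c : EuclideanSpace ℝ (Fin n) → Y → ℝ)
    (g : Fin N → EuclideanSpace ℝ (Fin n) → EuclideanSpace ℝ (Fin n))
    (hc : ∀ j, StorageFees.IsC1With X (fun x => c x (y j)) (g j))
    (htwist : StorageFees.Twist X g)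
    (F : (Fin N → ℝ) → EReal) (hF : StorageFees.IsStorageFee F)
    (μ : Measure X) [IsProbabilityMeasure μ]
    (hμ : μ.map (Subtype.val : X → EuclideanSpace ℝ (Fin n)) ≪ volume) :
    (∀ (φ : X → ℝ) (ψ : Fin N → ℝ) (γ : Measure (X × Y)) (w : Fin N → ℝ),
      StorageFees.IsDualMaximizer c y F μ φ ψ →
      StorageFees.IsPrimalMinimizer c y F μ γ w →
        ψ ∈ StorageFees.subdiff F w ∧
        StorageFees.CellMasses c y μ w ψ ∧
        ∀ j, 0 < w j →
          ψ j = StorageFees.ctrans c y (StorageFees.cstar (X := X) c y ψ) j) ∧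
    (∀ (w ψ : Fin N → ℝ), w ∈ StorageFees.weights N →
      ψ ∈ StorageFees.subdiff F w →
      StorageFees.CellMasses c y μ w ψ →
        StorageFees.IsDualMaximizer c y F μ (StorageFees.cstar c y ψ) ψ ∧
        (∀ᵐ x ∂μ, ∃! j, StorageFees.Attains c y ψ x j) ∧
        (∃ T : X → Y, Measurable T ∧ StorageFees.IsMapOf c y ψ T) ∧
        ∀ T : X → Y, StorageFees.IsMapOf c y ψ T →
          StorageFees.IsPrimalMinimizer c y F μ (μ.map (fun x => (x, T x))) w) := by

  have hne : Nonempty (Fin N) := hF.nonempty_fin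
  have hcpt : CompactSpace X := isCompact_iff_compactSpace.1 hX
  have hcont : ∀ j, Continuous fun x : X => c x (y j) := fun j => (hc j).continuous_restrict
  have hu := StorageFees.ae_existsUnique_attains hX hc htwist hμ
  refine ⟨fun φ ψ γ w hd hp => ?_, fun w ψ hw hψ hcell => ?_⟩
  · obtain ⟨hsub, hatt⟩ := StorageFees.complementary_slackness hF hcont (hu ψ) hd hp
    have hcell := StorageFees.cellMasses_of_ae_attains hcont (hu ψ) hp.1 hp.2.1 hatt
    refine ⟨hsub, hcell, fun j hj => ?_⟩
    -- A cell of positive mass contains a point, and one such point already fixes the transform at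
    -- `j`.
    obtain ⟨x, hx⟩ : {x : X | StorageFees.Attains c y ψ x j}.Nonempty := by
      refine nonempty_of_measure_ne_zero (μ := μ) fun h0 => hj.ne' ?_
      rw [hcell j, measureReal_def]
      exact (congrArg ENNReal.toReal h0).trans ENNReal.toReal_zero
    exact (StorageFees.ctrans_cstar_eq hx).symm
  · obtain ⟨T₀, hT₀m, hT₀⟩ := StorageFees.exists_measurable_isMapOf (X := X) hcont ψ
    have hopt := StorageFees.optimal_of_mem_subdiff hF hcont (hu ψ) hw hψ hcell hT₀ hT₀m
    refine ⟨hopt.1, hu ψ, ⟨T₀, hT₀m, hT₀⟩, fun T hT => ?_⟩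
    -- `T` need not be measurable, but it agrees almost everywhere with the measurable `T₀`, so the
    -- two plans coincide.
    have hmap : μ.map (fun x => (x, T x)) = μ.map fun x => (x, T₀ x) := by
      refine Measure.map_congr ?_
      filter_upwards [hT.ae_eq hT₀ (hu ψ)] with x hx
      rw [hx]
    rw [hmap]
    exact hopt.2
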